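/- Let $\mathcal H_A=\mathcal H_B=\ell^2(\mathbb N_{\ge1})$ with standard orthonormal basis $\{|n\rangle\}_{n\ge1}$, and let $\mathcal H=\mathcal H_A\otimes\mathcal H_B$. For a bounded operator $T$ put $\|T\|_1=\operatorname{Tr}\sqrt{T^\dagger T}\in[0,\infty]$; a state is a positive operator of trace one. Let $\mathcal S$ be the set of separable states on $\mathcal H$, i.e. the trace-norm closed convex hull of the projections $|\psi\rangle\langle\psi|$ onto unit product vectors $|\psi\rangle=|\psi_A\rangle\otimes|\psi_B\rangle$. Let $\rho^\Gamma$ be the partial transpose of $\rho$ in the second factor, $\langle ab|\rho^\Gamma|cd\rangle=\langle ad|\rho|cb\rangle$. For a state $\rho$ on $\mathcal H$ define the negativity $N(\rho)=\frac12(\|\rho^\Gamma\|_1-1)$, the standard robustness $$R^{s}_{\mathcal S}(\rho)=\inf\Big\{1+\lambda:\ \lambda\ge0,\ \exists\,\sigma\in\mathcal S,\ \tfrac{\rho+\lambda\sigma}{1+\lambda}\in\mathcal S\Big\},$$ and the generalized robustness $$R_{\mathcal S}(\rho)=\inf\Big\{1+\lambda:\ \lambda\ge0,\ \exists\text{ states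 }\tau_k\text{ and bounded operators }\xi_k\text{ with }\|\xi_k-\rho\|_1\to0\text{ and }\tfrac{\xi_k+\lambda\tau_k}{1+\lambda}\in\mathcal S\ \forall k\Big\},$$ with $\inf\emptyset=\infty$. The Hilbert matrix $(H_{-1})_{n,m}=\frac1{n-m}$ for $n\ne m$, $(H_{-1})_{n,n}=0$ ($n,m\ge1$) defines a bounded operator $H_{-1}$ on $\mathcal H_A$. Let $D=\sum_{n\ge1}\frac{1}{\sqrt n\,\ln(n+1)}|n\rangle\langle n|$, $c=\operatorname{Tr}D^2=\sum_{n\ge1}\frac1{n\ln^2(n+1)}$, which is positive and finite, and $$\omega_\pm=\frac1c\,D\Big(\mathbb 1\pm\frac{i}{\pi}H_{-1}\Big)D,\qquad \rho_\pm=\sum_{n,m\ge1}(\omega_\pm)_{n,m}\,|nn\rangle\langle mm| .$$ Then $D$, $\rho_\pm$ and $\rho_\pm^\Gamma$ are (well-defined) bounded operators, $\omega_\pm$ and $\rho_\pm$ are states, and: 1. $\|\rho_\pm^\Gamma\|_1=\infty$, so that $N(\rho_\pm)=\infty$, and $R^{s}_{\mathcal S}(\rho_\pm)=\infty$; 2.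 $\frac12(\rho_++\rho_-)\in\mathcal S$, and $R_{\mathcal S}(\rho_\pm)\le2$. -/

import Mathlib

open scoped ENNReal Topology lp InnerProductSpace ComplexOrder
open Filter

noncomputable section

/-- The standard orthonormal basis vector `|i⟩` of `ℓ²(ι)`. -/
def ket {ι : Type} [DecidableEq ι] (i : ι) : ℓ²(ι, ℂ) := lp.single 2 i (1 : ℂ)

/-- `T` is the bounded operator on `ℓ²(ι)` with matrix elements `⟨i|T|j⟩ = a i j`. -/
def HasMatrix {ι : Type} [DecidableEq ι] (T : ℓ²(ι, ℂ) →L[ℂ] ℓ²(ι, ℂ)) (a : ι → ι → ℂ) : Prop :=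
  ∀ i j, ⟪ket i, T (ket j)⟫_ℂ = a i j

open Classical in
/-- The (unique) bounded operator on `ℓ²(ι)` whose matrix elements are `a i j`, if there is one;
the value is `0` if there is none. -/
def opOfMatrix {ι : Type} [DecidableEq ι] (a : ι → ι → ℂ) : ℓ²(ι, ℂ) →L[ℂ] ℓ²(ι, ℂ) :=
  if h : ∃ T : ℓ²(ι, ℂ) →L[ℂ] ℓ²(ι, ℂ), HasMatrix T a then h.choose else 0

/-- The absolute value `|T| = √(T† T)` of a bounded operator on a Hilbert space. -/
def opAbs {E : Type} [NormedAddCommGroup E] [InnerProductSpace ℂ E] [CompleteSpace E]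
    (T : E →L[ℂ] E) : E →L[ℂ] E := CFC.abs T

/-- The trace norm `‖T‖₁ = Tr |T|`, `|T| = √(T† T)`, of a bounded operator, with values in
`[0, ∞]`. The trace of the positive operator `|T|` is evaluated in the standard basis. -/
def traceNorm {ι : Type} [DecidableEq ι] (T : ℓ²(ι, ℂ) →L[ℂ] ℓ²(ι, ℂ)) : ℝ≥0∞ :=
  ∑' i, ENNReal.ofReal (⟪ket i, opAbs T (ket i)⟫_ℂ).re

/-- Density operators: positive operators of trace one. -/
def densityOperators (ι : Type) [DecidableEq ι] : Set (ℓ²(ι, ℂ) →L[ℂ] ℓ²(ι, ℂ)) :=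
  {ρ | ρ.IsPositive ∧ HasSum (fun i => ⟪ket i, ρ (ket i)⟫_ℂ) 1}

/-- Convergence of a sequence of operators in trace norm. -/
def TraceNormTendsto {ι : Type} [DecidableEq ι] (ξ : ℕ → ℓ²(ι, ℂ) →L[ℂ] ℓ²(ι, ℂ))
    (ρ : ℓ²(ι, ℂ) →L[ℂ] ℓ²(ι, ℂ)) : Prop :=
  Tendsto (fun k => traceNorm (ξ k - ρ)) atTop (𝓝 0)

/-- The closure of a set of operators in trace norm. -/
def traceNormClosure {ι : Type} [DecidableEq ι] (S : Set (ℓ²(ι, ℂ) →L[ℂ] ℓ²(ι, ℂ))) :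
    Set (ℓ²(ι, ℂ) →L[ℂ] ℓ²(ι, ℂ)) :=
  {ρ | ∃ ξ : ℕ → ℓ²(ι, ℂ) →L[ℂ] ℓ²(ι, ℂ), (∀ k, ξ k ∈ S) ∧ TraceNormTendsto ξ ρ}

/-- The standard robustness with respect to the set `F` of free states
(`∞` if no decomposition exists). -/
def standardRobustness {ι : Type} [DecidableEq ι] (F : Set (ℓ²(ι, ℂ) →L[ℂ] ℓ²(ι, ℂ)))
    (ρ : ℓ²(ι, ℂ) →L[ℂ] ℓ²(ι, ℂ)) : ℝ≥0∞ :=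
  sInf {r | ∃ t : ℝ, 0 ≤ t ∧ r = ENNReal.ofReal (1 + t) ∧
    ∃ σ ∈ F, ((1 + t : ℝ) : ℂ)⁻¹ • (ρ + (t : ℂ) • σ) ∈ F}

/-- The (lower semicontinuous) generalized robustness with respect to the set `F` of free states:
the infimum of `1 + t` such that `(ξ k + t τ k) / (1 + t)` is free for all `k`, for some density
operators `τ k` and some sequence of bounded operators `ξ k` converging to `ρ` in trace norm. -/
def generalizedRobustness {ι : Type} [DecidableEq ι] (F : Set (ℓ²(ι, ℂ) →L[ℂ] ℓ²(ι, ℂ)))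
    (ρ : ℓ²(ι, ℂ) →L[ℂ] ℓ²(ι, ℂ)) : ℝ≥0∞ :=
  sInf {r | ∃ t : ℝ, 0 ≤ t ∧ r = ENNReal.ofReal (1 + t) ∧
    ∃ ξ τ : ℕ → ℓ²(ι, ℂ) →L[ℂ] ℓ²(ι, ℂ), TraceNormTendsto ξ ρ ∧
      ∀ k, τ k ∈ densityOperators ι ∧ ((1 + t : ℝ) : ℂ)⁻¹ • (ξ k + (t : ℂ) • τ k) ∈ F}

/-- The single-party space `H_A = H_B`, with orthonormal basis `|n⟩`, `n ≥ 1`. -/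
abbrev HA : Type := ℓ²(ℕ+, ℂ)

/-- The bipartite space `H_A ⊗ H_B`, realised as `ℓ²(ℕ+ × ℕ+)` with `|n⟩ ⊗ |m⟩ = |(n, m)⟩`. -/
abbrev HAB : Type := ℓ²(ℕ+ × ℕ+, ℂ)

/-- `Ψ = ψ ⊗ φ`: the coordinates satisfy `Ψ (n, m) = ψ n * φ m`. -/
def IsTensor (Ψ : HAB) (ψ φ : HA) : Prop := ∀ n m : ℕ+, Ψ (n, m) = ψ n * φ m

/-- The pure product states `|Ψ⟩⟨Ψ|`, `Ψ = ψ ⊗ φ` a unit vector. -/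
def productStates : Set (HAB →L[ℂ] HAB) :=
  {P | ∃ (Ψ : HAB) (ψ φ : HA), ‖Ψ‖ = 1 ∧ IsTensor Ψ ψ φ ∧ P = InnerProductSpace.rankOne ℂ Ψ Ψ}

/-- The separable states: the trace-norm closed convex hull of the pure product states. -/
def separableStates : Set (HAB →L[ℂ] HAB) := traceNormClosure (convexHull ℝ productStates)

/-- Matrix elements of the partial transpose (on the second factor):
`⟨a b| X^Γ |c d⟩ = ⟨a d| X |c b⟩`. -/
def partialTransposeMatrix (X : HAB →L[ℂ] HAB) (p q : ℕ+ × ℕ+) : ℂ :=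
  ⟪ket (p.1, q.2), X (ket (q.1, p.2))⟫_ℂ

/-- The partial transpose `X^Γ`. -/
def partialTranspose (X : HAB →L[ℂ] HAB) : HAB →L[ℂ] HAB := opOfMatrix (partialTransposeMatrix X)

/-- The entanglement negativity `(‖ρ^Γ‖₁ - 1) / 2`. -/
def negativity (ρ : HAB →L[ℂ] HAB) : EReal := ((traceNorm (partialTranspose ρ) : EReal) - 1) / 2

/-- Matrix elements `1 / (n - m)` (and `0` on the diagonal) of the Hilbert operator `H_{-1}`. -/
def hilbertMatrix (n m : ℕ+) : ℂ := if n = m then 0 else 1 / (((n : ℕ) : ℂ) - ((m : ℕ) : ℂ))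

/-- The Hilbert operator `H_{-1}`. -/
def hilbertOperator : HA →L[ℂ] HA := opOfMatrix hilbertMatrix

/-- The weights `1 / (√n ln(n+1))`. -/
def weight (n : ℕ+) : ℝ := 1 / (Real.sqrt (n : ℕ) * Real.log ((n : ℕ) + 1))

/-- Matrix elements of the diagonal operator `D`. -/
def weightMatrix (n m : ℕ+) : ℂ := if n = m then (weight n : ℂ) else 0

/-- The diagonal operator `D = ∑ₙ 1 / (√n ln(n+1)) |n⟩⟨n|`. -/
def weightOperator : HA →L[ℂ] HA := opOfMatrix weightMatrix

/-- The normalization constant `c = Tr D² = ∑ₙ 1 / (n ln(n+1)²)`. -/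
def normConst : ℝ := ∑' n : ℕ+, weight n ^ 2

/-- `ω_± = c⁻¹ D (1 ± (i/π) H_{-1}) D`, the sign being `s = ±1`. -/
def omega (s : ℤˣ) : HA →L[ℂ] HA :=
  (normConst : ℂ)⁻¹ •
    (weightOperator * (1 + (((s : ℤ) : ℂ) * (Complex.I / (Real.pi : ℂ))) • hilbertOperator) *
      weightOperator)

/-- Matrix elements of `∑_{n,m} ω_{n,m} |nn⟩⟨mm|`. -/
def rhoMatrix (s : ℤˣ) (p q : ℕ+ × ℕ+) : ℂ :=
  if p.1 = p.2 ∧ q.1 = q.2 then ⟪ket p.1, omega s (ket q.1)⟫_ℂ else 0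

/-- The bipartite operators `ρ_± = ∑_{n,m} (ω_±)_{n,m} |nn⟩⟨mm|`. -/
def rho (s : ℤˣ) : HAB →L[ℂ] HAB := opOfMatrix (rhoMatrix s)

end

/-! Positivity comes from Fourier analysis: `1 ± (i/π) H₋₁` is the Toeplitz operator whose symbol is
the sawtooth `1 ± (2x - 1)` on `(0, 1]`, with values in `[0, 2]` (`one_add_hilbertOperator`). So
`ω_±` is positive, and conjugating by the isometry `|n⟩ ↦ |nn⟩` makes `ρ_±` a state.

Both infinities come from `∑ |ω_{nm}| = ∞` (`tsum_norm_inner_ket_omega`): the entries near the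
diagonal contribute at least a multiple of `∑ 1/(n log(n+1))`, although the trace `∑ 1/(n
log²(n+1))` converges. The partial transpose of `ρ_±` is a weighted swap, so its trace norm is
exactly this sum. For the standard robustness, `∑ |⟨aa|σ|bb⟩| ≤ 1` for every separable `σ`
(`sum_norm_inner_ket_le_of_separable`), so a decomposition `ρ = (1+t)τ - tσ` would force `∑ |ω_{nm}|
≤ 1 + 2t`.

In `ρ_+ + ρ_-` the off-diagonal entries cancel, leaving a mixture of the product states `|nn⟩⟨nn|`;
mixing `ρ_±` with `ρ_∓` at `t = 1` then bounds the generalized robustness by 2. -/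

lemma summable_norm_sq {ι : Type} (f : ℓ²(ι, ℂ)) : Summable fun i => ‖f i‖ ^ 2 := by
  have h := (lp.memℓp f).summable (by norm_num)
  simpa using h

lemma norm_sq_eq_tsum {ι : Type} (f : ℓ²(ι, ℂ)) : ‖f‖ ^ 2 = ∑' i, ‖f i‖ ^ 2 := by
  have h := lp.norm_rpow_eq_tsum (p := 2) (by norm_num) f
  simpa using h

/-! ### Matrix elements determine bounded operators on `ℓ²`. -/

section Basis

variable {ι : Type} [DecidableEq ι]

lemma ket_apply (i j : ι) : (ket i : ℓ²(ι, ℂ)) j = if j = i then 1 else 0 := by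
  rw [ket, lp.single_apply, Pi.single_apply]

lemma norm_ket (i : ι) : ‖(ket i : ℓ²(ι, ℂ))‖ = 1 := by
  rw [ket, lp.norm_single (by norm_num), norm_one]

lemma inner_ket_left (i : ι) (f : ℓ²(ι, ℂ)) : ⟪ket i, f⟫_ℂ = f i := by
  rw [ket, lp.inner_single_left]
  simp

lemma inner_ket_right (i : ι) (f : ℓ²(ι, ℂ)) : ⟪f, ket i⟫_ℂ = star (f i) := by
  rw [← inner_conj_symm, inner_ket_left]
  rfl

lemma clm_ext_ket {F : Type*} [NormedAddCommGroup F] [NormedSpace ℂ F]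
    {S T : ℓ²(ι, ℂ) →L[ℂ] F} (h : ∀ i, S (ket i) = T (ket i)) : S = T := by
  refine lp.ext_continuousLinearMap (by norm_num) fun i => ?_
  ext
  exact h i

lemma HasMatrix.ext {S T : ℓ²(ι, ℂ) →L[ℂ] ℓ²(ι, ℂ)} {a : ι → ι → ℂ}
    (hS : HasMatrix S a) (hT : HasMatrix T a) : S = T := by
  refine clm_ext_ket fun j => ?_
  ext i
  rw [← inner_ket_left, ← inner_ket_left, hS, hT]

lemma HasMatrix.opOfMatrix_eq {T : ℓ²(ι, ℂ) →L[ℂ] ℓ²(ι, ℂ)} {a : ι → ι → ℂ}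
    (hT : HasMatrix T a) : opOfMatrix a = T := by
  have h : ∃ T : ℓ²(ι, ℂ) →L[ℂ] ℓ²(ι, ℂ), HasMatrix T a := ⟨T, hT⟩
  rw [opOfMatrix, dif_pos h]
  exact h.choose_spec.ext hT

lemma HasMatrix.opOfMatrix {T : ℓ²(ι, ℂ) →L[ℂ] ℓ²(ι, ℂ)} {a : ι → ι → ℂ}
    (hT : HasMatrix T a) : HasMatrix (opOfMatrix a) a :=
  hT.opOfMatrix_eq.symm ▸ hT

end Basis

/-! ### Absolute values and positive operators. -/

section OpAbs

variable {E : Type} [NormedAddCommGroup E] [InnerProductSpace ℂ E] [CompleteSpace E]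

lemma opAbs_eq_of_isPositive {T B : E →L[ℂ] E} (hB : B.IsPositive)
    (h : star T * T = B * B) : opAbs T = B := by
  rw [opAbs, CFC.abs, h]
  exact CFC.sqrt_mul_self B ((ContinuousLinearMap.nonneg_iff_isPositive B).2 hB)

lemma isPositive_opAbs (T : E →L[ℂ] E) : (opAbs T).IsPositive :=
  (ContinuousLinearMap.nonneg_iff_isPositive _).1 (CFC.abs_nonneg T)

lemma norm_opAbs_apply (T : E →L[ℂ] E) (x : E) : ‖opAbs T x‖ = ‖T x‖ := by
  have h : opAbs T * opAbs T = star T * T := CFC.abs_mul_abs T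
  have h2 : ⟪opAbs T x, opAbs T x⟫_ℂ = ⟪T x, T x⟫_ℂ := by
    rw [← ContinuousLinearMap.adjoint_inner_right, (isPositive_opAbs T).isSelfAdjoint.adjoint_eq,
      ← mul_apply_eq_comp, h, mul_apply_eq_comp,
      ContinuousLinearMap.star_eq_adjoint, ContinuousLinearMap.adjoint_inner_right]
  rw [inner_self_eq_norm_sq_to_K, inner_self_eq_norm_sq_to_K] at h2
  have h3 : ‖opAbs T x‖ ^ 2 = ‖T x‖ ^ 2 := by exact_mod_cast h2
  exact (sq_eq_sq₀ (norm_nonneg _) (norm_nonneg _)).1 h3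

/-- Cauchy–Schwarz applied to the vectors `√A x` and `√A y`. -/
lemma ContinuousLinearMap.IsPositive.norm_inner_sq_le {A : E →L[ℂ] E} (hA : A.IsPositive)
    (x y : E) : ‖⟪x, A y⟫_ℂ‖ ^ 2 ≤ (⟪x, A x⟫_ℂ).re * (⟪y, A y⟫_ℂ).re := by
  have hA0 : 0 ≤ A := (ContinuousLinearMap.nonneg_iff_isPositive A).2 hA
  have hR : (CFC.sqrt A).IsPositive :=
    (ContinuousLinearMap.nonneg_iff_isPositive _).1 (CFC.sqrt_nonneg A)
  have key : ∀ u v : E, ⟪u, A v⟫_ℂ = ⟪CFC.sqrt A u, CFC.sqrt A v⟫_ℂ := fun u v => by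
    rw [← ContinuousLinearMap.adjoint_inner_right, hR.isSelfAdjoint.adjoint_eq,
      ← mul_apply_eq_comp, CFC.sqrt_mul_sqrt_self A hA0]
  have hre : ∀ u : E, (⟪u, A u⟫_ℂ).re = ‖CFC.sqrt A u‖ ^ 2 := fun u => by
    rw [key, inner_self_eq_norm_sq_to_K]
    norm_cast
  rw [hre, hre, key, ← mul_pow]
  gcongr
  exact norm_inner_le_norm _ _

end OpAbs

/-! ### Weighted permutation operators and their trace norms. -/

section WeightedPerm

variable {ι : Type} [DecidableEq ι]

lemma memℓp_weightedPerm {ι : Type} (σ : Equiv.Perm ι) {a : ι → ℂ} {C : ℝ} (ha : ∀ i, ‖a i‖ ≤ C)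
    (f : ℓ²(ι, ℂ)) : Memℓp (fun i => a i * f (σ i)) 2 := by
  rw [memℓp_gen_iff (by norm_num)]
  have h : Summable fun i => C ^ 2 * ‖f (σ i)‖ ^ 2 :=
    ((σ.summable_iff (f := fun i => ‖f i‖ ^ 2)).2 (summable_norm_sq f)).mul_left _
  refine Summable.of_nonneg_of_le (fun i => by positivity) (fun i => ?_) h
  simp only [ENNReal.toReal_ofNat, Real.rpow_ofNat, norm_mul, mul_pow]
  gcongr
  exact ha i

/-- The bounded operator `f ↦ (i ↦ a i * f (σ i))` on `ℓ²`. -/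
noncomputable def weightedPerm (σ : Equiv.Perm ι) (a : ι → ℂ) {C : ℝ} (ha : ∀ i, ‖a i‖ ≤ C) :
    ℓ²(ι, ℂ) →L[ℂ] ℓ²(ι, ℂ) :=
  LinearMap.mkContinuous
    { toFun := fun f => ⟨fun i => a i * f (σ i), memℓp_weightedPerm σ ha f⟩
      map_add' := fun f g => by
        ext i
        exact mul_add _ _ _
      map_smul' := fun c f => by
        ext i
        simp [mul_left_comm] } |C| (fun f => by
      refine (sq_le_sq₀ (norm_nonneg _) (by positivity)).1 ?_
      rw [mul_pow, norm_sq_eq_tsum, norm_sq_eq_tsum f, ← σ.tsum_eq fun i => ‖f i‖ ^ 2,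
        ← tsum_mul_left, sq_abs]
      have hs : Summable fun i => C ^ 2 * ‖f (σ i)‖ ^ 2 :=
        ((σ.summable_iff (f := fun i => ‖f i‖ ^ 2)).2 (summable_norm_sq f)).mul_left _
      have hle : ∀ i, ‖a i * f (σ i)‖ ^ 2 ≤ C ^ 2 * ‖f (σ i)‖ ^ 2 := fun i => by
        rw [norm_mul, mul_pow]
        gcongr
        exact ha i
      exact (Summable.of_nonneg_of_le (fun i => by positivity) hle hs).tsum_le_tsum hle hs)

variable (σ : Equiv.Perm ι) {a : ι → ℂ} {C : ℝ} (ha : ∀ i, ‖a i‖ ≤ C)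

omit [DecidableEq ι] in
lemma weightedPerm_apply (f : ℓ²(ι, ℂ)) (i : ι) : weightedPerm σ a ha f i = a i * f (σ i) := rfl

lemma weightedPerm_ket (j : ι) :
    weightedPerm σ a ha (ket j) = a (σ.symm j) • ket (σ.symm j) := by
  ext i
  rw [weightedPerm_apply, lp.coeFn_smul, Pi.smul_apply, ket_apply, ket_apply, smul_eq_mul]
  by_cases h : σ i = j
  · simp [← h]
  · rw [if_neg h, if_neg (fun h' => h (by simp [h']))]
    simp

lemma hasMatrix_weightedPerm :
    HasMatrix (weightedPerm σ a ha) fun i j => if σ i = j then a i else 0 := by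
  intro i j
  rw [inner_ket_left, weightedPerm_apply, ket_apply]
  simp

/-- The diagonal operator with diagonal entries `a`. -/
noncomputable abbrev diagOp (a : ι → ℂ) {C : ℝ} (ha : ∀ i, ‖a i‖ ≤ C) :
    ℓ²(ι, ℂ) →L[ℂ] ℓ²(ι, ℂ) :=
  weightedPerm (Equiv.refl ι) a ha

lemma diagOp_ket (j : ι) : diagOp a ha (ket j) = a j • ket j :=
  weightedPerm_ket _ ha j

omit [DecidableEq ι] in
lemma isPositive_diagOp {b : ι → ℝ} (hb : ∀ i, 0 ≤ b i) (hbC : ∀ i, ‖(b i : ℂ)‖ ≤ C) :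
    (diagOp (fun i => (b i : ℂ)) hbC).IsPositive := by
  rw [ContinuousLinearMap.isPositive_iff_complex]
  intro x
  have h : ⟪diagOp (fun i => (b i : ℂ)) hbC x, x⟫_ℂ = ((∑' i, b i * ‖x i‖ ^ 2 : ℝ) : ℂ) := by
    rw [lp.inner_eq_tsum, Complex.ofReal_tsum]
    refine tsum_congr fun i => ?_
    rw [weightedPerm_apply, RCLike.inner_apply]
    simp only [Equiv.refl_apply, map_mul, Complex.conj_ofReal]
    push_cast
    rw [← Complex.mul_conj']
    ring
  rw [h]
  refine ⟨by simp, ?_⟩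
  simpa using tsum_nonneg fun i => mul_nonneg (hb i) (sq_nonneg _)

/-- Basis vectors go to multiples of distinct basis vectors, so `T† T` is diagonal and its positive
square root can be read off. -/
lemma opAbs_weightedPerm (hb : ∀ i, ‖((‖a (σ.symm i)‖ : ℝ) : ℂ)‖ ≤ C) :
    opAbs (weightedPerm σ a ha) = diagOp (fun i => ((‖a (σ.symm i)‖ : ℝ) : ℂ)) hb := by
  set B := diagOp (fun i => ((‖a (σ.symm i)‖ : ℝ) : ℂ)) hb with hB
  have hpos : B.IsPositive := isPositive_diagOp (fun i => norm_nonneg _) hb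
  have h : star (weightedPerm σ a ha) * weightedPerm σ a ha = B * B := by
    refine clm_ext_ket fun j => ?_
    ext i
    rw [← inner_ket_left, ← inner_ket_left, mul_apply_eq_comp,
      ContinuousLinearMap.star_eq_adjoint, ContinuousLinearMap.adjoint_inner_right,
      weightedPerm_ket, weightedPerm_ket, mul_apply_eq_comp, hB, diagOp_ket,
      map_smul, diagOp_ket, inner_smul_left, inner_smul_right, inner_smul_right,
      inner_smul_right, inner_ket_left, inner_ket_left, ket_apply, ket_apply]
    by_cases hij : i = j
    · subst hij
      simp only [if_true, mul_one]
      rw [mul_comm, Complex.mul_conj', sq]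
    · simp [hij]
  exact opAbs_eq_of_isPositive hpos h

lemma traceNorm_weightedPerm :
    traceNorm (weightedPerm σ a ha) = ∑' i, ENNReal.ofReal ‖a i‖ := by
  have hb : ∀ i, ‖((‖a (σ.symm i)‖ : ℝ) : ℂ)‖ ≤ C := fun i => by simpa using ha _
  rw [traceNorm, ← σ.symm.tsum_eq fun i => ENNReal.ofReal ‖a i‖]
  refine tsum_congr fun i => ?_
  rw [opAbs_weightedPerm σ ha hb, diagOp_ket, inner_smul_right, inner_ket_left, ket_apply]
  simp

end WeightedPerm

/-! ### Trace-norm convergence implies entrywise convergence. -/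

section TraceNormBound

variable {ι : Type} [DecidableEq ι]

/-- With `p` the diagonal of `|T|`, the entry is at most `‖T e_j‖ = ‖|T| e_j‖`, and positivity of
`|T|` gives `‖|T| e_j‖² ≤ ∑ₖ pₖ pⱼ ≤ (∑ p)²`. -/
lemma norm_inner_ket_le_traceNorm (T : ℓ²(ι, ℂ) →L[ℂ] ℓ²(ι, ℂ)) (i j : ι) :
    ENNReal.ofReal ‖⟪ket i, T (ket j)⟫_ℂ‖ ≤ traceNorm T := by
  by_cases htop : traceNorm T = ⊤
  · simp [htop]
  set p : ι → ℝ := fun i => (⟪ket i, opAbs T (ket i)⟫_ℂ).re with hp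
  have hp0 : ∀ i, 0 ≤ p i := fun i => (isPositive_opAbs T).re_inner_nonneg_right _
  have hsum : Summable p := by
    have := ENNReal.summable_toReal htop
    exact this.congr fun i => ENNReal.toReal_ofReal (hp0 i)
  have htr : traceNorm T = ENNReal.ofReal (∑' i, p i) :=
    (ENNReal.ofReal_tsum_of_nonneg hp0 hsum).symm
  rw [htr]
  refine ENNReal.ofReal_le_ofReal ?_
  have h1 : ‖⟪ket i, T (ket j)⟫_ℂ‖ ≤ ‖opAbs T (ket j)‖ := by
    rw [norm_opAbs_apply]
    simpa [norm_ket] using norm_inner_le_norm (𝕜 := ℂ) (ket i) (T (ket j))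
  refine h1.trans ?_
  have hpj : p j ≤ ∑' i, p i := hsum.le_tsum j fun i _ => hp0 i
  refine (sq_le_sq₀ (norm_nonneg _) (tsum_nonneg hp0)).1 ?_
  rw [norm_sq_eq_tsum]
  calc ∑' k, ‖opAbs T (ket j) k‖ ^ 2 ≤ ∑' k, p k * p j := by
        refine (summable_norm_sq _).tsum_le_tsum (fun k => ?_) (hsum.mul_right _)
        rw [← inner_ket_left]
        exact (isPositive_opAbs T).norm_inner_sq_le _ _
    _ = (∑' k, p k) * p j := tsum_mul_right
    _ ≤ (∑' k, p k) ^ 2 := by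
        rw [sq]
        exact mul_le_mul_of_nonneg_left hpj (tsum_nonneg hp0)

lemma TraceNormTendsto.tendsto_inner_ket {ξ : ℕ → ℓ²(ι, ℂ) →L[ℂ] ℓ²(ι, ℂ)}
    {ρ : ℓ²(ι, ℂ) →L[ℂ] ℓ²(ι, ℂ)} (h : TraceNormTendsto ξ ρ) (i j : ι) :
    Tendsto (fun k => ⟪ket i, ξ k (ket j)⟫_ℂ) atTop (𝓝 ⟪ket i, ρ (ket j)⟫_ℂ) := by
  rw [tendsto_iff_norm_sub_tendsto_zero]
  have h1 : Tendsto (fun k => ENNReal.ofReal ‖⟪ket i, (ξ k - ρ) (ket j)⟫_ℂ‖) atTop (𝓝 0) :=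
    tendsto_of_tendsto_of_tendsto_of_le_of_le tendsto_const_nhds h (fun _ => zero_le)
      fun k => norm_inner_ket_le_traceNorm _ _ _
  have h2 := (ENNReal.tendsto_toReal ENNReal.zero_ne_top).comp h1
  simpa [Function.comp_def, inner_sub_right] using h2

end TraceNormBound

/-! ### Toeplitz operators as compressions of multiplication operators on the circle. -/

section Toeplitz

open MeasureTheory AddCircle

/-- Multiplication by a bounded measurable function on `L²` of the circle. -/
noncomputable def circleMul (u : Lp ℂ ∞ (haarAddCircle (T := (1 : ℝ)))) :
    Lp ℂ 2 (haarAddCircle (T := (1 : ℝ))) →L[ℂ] Lp ℂ 2 (haarAddCircle (T := (1 : ℝ))) :=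
  (ContinuousLinearMap.mul ℂ ℂ).holderL haarAddCircle ∞ 2 2 u

lemma inner_circleMul (u : Lp ℂ ∞ (haarAddCircle (T := (1 : ℝ))))
    (f g : Lp ℂ 2 (haarAddCircle (T := (1 : ℝ)))) :
    ⟪f, circleMul u g⟫_ℂ = ∫ x, u x * g x * star (f x) ∂haarAddCircle := by
  rw [L2.inner_def]
  refine integral_congr_ae ?_
  filter_upwards [(ContinuousLinearMap.mul ℂ ℂ).coeFn_holder (r := 2) u g] with x hx
  rw [circleMul, ContinuousLinearMap.holderL_apply_apply, hx, RCLike.inner_apply]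
  rfl

lemma isPositive_circleMul {u : Lp ℂ ∞ (haarAddCircle (T := (1 : ℝ)))}
    (hu : ∀ᵐ x ∂haarAddCircle, 0 ≤ u x) : (circleMul u).IsPositive := by
  rw [ContinuousLinearMap.isPositive_iff_complex]
  intro f
  have h : ⟪f, circleMul u f⟫_ℂ = ((∫ x, (u x).re * ‖f x‖ ^ 2 ∂haarAddCircle : ℝ) : ℂ) := by
    rw [inner_circleMul, ← integral_complex_ofReal]
    refine integral_congr_ae ?_
    filter_upwards [hu] with x hx
    have hx' : u x = ((u x).re : ℂ) := by
      rw [Complex.nonneg_iff] at hx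
      exact Complex.ext rfl hx.2.symm
    rw [mul_assoc]
    nth_rewrite 1 [hx']
    push_cast
    rw [← Complex.mul_conj']
    rfl
  have h0 : 0 ≤ ∫ x, (u x).re * ‖f x‖ ^ 2 ∂haarAddCircle := by
    refine integral_nonneg_of_ae ?_
    filter_upwards [hu] with x hx
    exact mul_nonneg (Complex.nonneg_iff.1 hx).1 (sq_nonneg _)
  have h' : ⟪circleMul u f, f⟫_ℂ = ((∫ x, (u x).re * ‖f x‖ ^ 2 ∂haarAddCircle : ℝ) : ℂ) := by
    rw [← inner_conj_symm, h, Complex.conj_ofReal]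
  rw [h']
  exact ⟨by simp, by simpa using h0⟩

lemma orthonormal_fourier_pnat :
    Orthonormal ℂ fun n : ℕ+ => fourierLp (T := (1 : ℝ)) 2 (n : ℤ) :=
  orthonormal_fourier.comp (fun n : ℕ+ => ((n : ℕ) : ℤ)) fun a b h => by
    simpa using h

/-- The embedding of `ℓ²(ℕ+)` in `L²` of the circle as the span of the positive frequencies. -/
noncomputable def hardyEmbedding : HA →L[ℂ] Lp ℂ 2 (haarAddCircle (T := (1 : ℝ))) :=
  orthonormal_fourier_pnat.orthogonalFamily.linearIsometry.toContinuousLinearMap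

lemma hardyEmbedding_ket (n : ℕ+) : hardyEmbedding (ket n) = fourierLp 2 (n : ℤ) := by
  have h := orthonormal_fourier_pnat.orthogonalFamily.linearIsometry_apply_single
    (i := n) (1 : ℂ)
  exact h.trans (one_smul ℂ _)

/-- The Toeplitz operator on `ℓ²(ℕ+)` with symbol `u`. -/
noncomputable def toeplitz (u : Lp ℂ ∞ (haarAddCircle (T := (1 : ℝ)))) : HA →L[ℂ] HA :=
  ContinuousLinearMap.adjoint hardyEmbedding ∘L circleMul u ∘L hardyEmbedding

lemma isPositive_toeplitz {u : Lp ℂ ∞ (haarAddCircle (T := (1 : ℝ)))}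
    (hu : ∀ᵐ x ∂haarAddCircle, 0 ≤ u x) : (toeplitz u).IsPositive :=
  (isPositive_circleMul hu).adjoint_conj hardyEmbedding

lemma hasMatrix_toeplitz (u : Lp ℂ ∞ (haarAddCircle (T := (1 : ℝ)))) :
    HasMatrix (toeplitz u) fun n m : ℕ+ => fourierCoeff u ((n : ℤ) - (m : ℤ)) := by
  intro n m
  rw [toeplitz, ContinuousLinearMap.comp_apply, ContinuousLinearMap.adjoint_inner_right,
    ContinuousLinearMap.comp_apply, hardyEmbedding_ket, hardyEmbedding_ket, inner_circleMul]
  refine integral_congr_ae ?_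
  filter_upwards [coeFn_fourierLp (T := (1 : ℝ)) 2 (n : ℤ),
    coeFn_fourierLp (T := (1 : ℝ)) 2 (m : ℤ)] with x hn hm
  rw [hn, hm, neg_sub, sub_eq_add_neg, fourier_add, fourier_neg, smul_eq_mul, mul_comm, mul_comm _ (u x),
    mul_left_comm]
  rw [mul_comm (fourier (m : ℤ) x)]
  rfl

end Toeplitz

/-! ### The sawtooth symbol and the Hilbert matrix. -/

section Sawtooth

open MeasureTheory AddCircle

/-- The function `1 + s (2 x - 1)`, `0 < x ≤ 1`, on the circle `ℝ / ℤ`. -/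
noncomputable def sawtooth (s : ℤˣ) : AddCircle (1 : ℝ) → ℂ :=
  liftIoc 1 0 fun x : ℝ => ((1 + ((s : ℤ) : ℝ) * (2 * x - 1) : ℝ) : ℂ)

lemma measurable_sawtooth (s : ℤˣ) : Measurable (sawtooth s) := by
  have h : sawtooth s = (fun x : ℝ => ((1 + ((s : ℤ) : ℝ) * (2 * x - 1) : ℝ) : ℂ)) ∘
      Subtype.val ∘ measurableEquivIoc 1 0 := rfl
  rw [h]
  exact (by fun_prop : Measurable fun x : ℝ => ((1 + ((s : ℤ) : ℝ) * (2 * x - 1) : ℝ) : ℂ)).comp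
    (measurable_subtype_coe.comp (measurableEquivIoc 1 0).measurable)

/-- The lower bound makes the Toeplitz operator positive; the upper bound makes it bounded. -/
lemma sawtooth_bounds (s : ℤˣ) (x : AddCircle (1 : ℝ)) :
    ∃ y : ℝ, sawtooth s x = y ∧ 0 ≤ y ∧ y ≤ 2 := by
  refine ⟨1 + ((s : ℤ) : ℝ) * (2 * (equivIoc 1 0 x : ℝ) - 1), rfl, ?_⟩
  have h := (equivIoc (1 : ℝ) 0 x).2
  obtain ⟨h1, h2⟩ := h
  rcases Int.units_eq_one_or s with rfl | rfl
  · constructor <;> push_cast <;> linarith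
  · constructor <;> push_cast <;> linarith

lemma memLp_sawtooth (s : ℤˣ) : MemLp (sawtooth s) ∞ (haarAddCircle (T := (1 : ℝ))) := by
  refine memLp_top_of_bound (measurable_sawtooth s).aestronglyMeasurable 2 (ae_of_all _ fun x => ?_)
  obtain ⟨y, hy, h0, h2⟩ := sawtooth_bounds s x
  rw [hy, Complex.norm_real, Real.norm_of_nonneg h0]
  exact h2

lemma fourierCoeff_sawtooth (s : ℤˣ) (k : ℤ) :
    fourierCoeff (sawtooth s) k =
      if k = 0 then 1 else ((s : ℤ) : ℂ) * (Complex.I / Real.pi) * (1 / (k : ℂ)) := by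
  -- The symbol is `B₀ + 2 s B₁` in Bernoulli polynomials, since `B₁(x) = x - 1/2`.
  have hlin : fourierCoeff (sawtooth s) k =
      bernoulliFourierCoeff 0 k + ((s : ℤ) : ℂ) * 2 * bernoulliFourierCoeff 1 k := by
    rw [sawtooth, fourierCoeff_liftIoc_eq, bernoulliFourierCoeff, bernoulliFourierCoeff,
      fourierCoeffOn_eq_integral, fourierCoeffOn_eq_integral, fourierCoeffOn_eq_integral]
    simp only [zero_add, sub_zero, div_one, one_smul]
    rw [← intervalIntegral.integral_const_mul, ← intervalIntegral.integral_add]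
    · refine intervalIntegral.integral_congr fun x _ => ?_
      simp only [bernoulliFun_zero, bernoulliFun_one, smul_eq_mul, fourier_coe_apply]
      push_cast
      ring_nf
    · refine Continuous.intervalIntegrable ?_ _ _
      fun_prop
    · refine Continuous.intervalIntegrable ?_ _ _
      fun_prop
  rw [hlin]
  split_ifs with hk
  · subst hk
    rw [bernoulliFourierCoeff_zero one_ne_zero, bernoulliFourierCoeff, fourierCoeffOn_eq_integral]
    simp
  · have hk' : (k : ℂ) ≠ 0 := by exact_mod_cast hk
    have hpi : (Real.pi : ℂ) ≠ 0 := by exact_mod_cast Real.pi_ne_zero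
    rw [bernoulli_zero_fourier_coeff hk, bernoulliFourierCoeff_eq one_ne_zero]
    field_simp
    simp

/-- The Toeplitz operator whose symbol is the sawtooth function. -/
noncomputable def sawtoothToeplitz (s : ℤˣ) : HA →L[ℂ] HA := toeplitz (memLp_sawtooth s).toLp

lemma isPositive_sawtoothToeplitz (s : ℤˣ) : (sawtoothToeplitz s).IsPositive := by
  refine isPositive_toeplitz ?_
  filter_upwards [(memLp_sawtooth s).coeFn_toLp] with x hx
  obtain ⟨y, hy, h0, -⟩ := sawtooth_bounds s x
  rw [hx, hy]
  exact_mod_cast h0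

lemma hasMatrix_sawtoothToeplitz (s : ℤˣ) :
    HasMatrix (sawtoothToeplitz s) fun n m =>
      (if n = m then 1 else 0) + ((s : ℤ) : ℂ) * (Complex.I / Real.pi) * hilbertMatrix n m := by
  intro n m
  simp only
  rw [sawtoothToeplitz, hasMatrix_toeplitz]
  simp only
  rw [fourierCoeff_congr_ae (memLp_sawtooth s).coeFn_toLp, fourierCoeff_sawtooth, hilbertMatrix]
  by_cases h : n = m
  · simp [h]
  · have h' : (n : ℤ) - (m : ℤ) ≠ 0 := fun h0 => h (by simpa [sub_eq_zero] using h0)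
    rw [if_neg h', if_neg h, if_neg h]
    push_cast
    ring

lemma hasMatrix_hilbertOperator : HasMatrix hilbertOperator hilbertMatrix := by
  -- Boundedness of `H₋₁` follows by solving `1 + (i/π) H = T` for `H`, with `T` the bounded
  -- Toeplitz operator.
  have h : HasMatrix ((-Complex.I * Real.pi) • (sawtoothToeplitz 1 - 1)) hilbertMatrix := by
    intro n m
    have hpi : (Real.pi : ℂ) ≠ 0 := by exact_mod_cast Real.pi_ne_zero
    rw [smul_apply, sub_apply, inner_smul_right,
      inner_sub_right, hasMatrix_sawtoothToeplitz, one_apply_eq_self, inner_ket_left,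
      ket_apply]
    field_simp
    simp
    rw [← mul_assoc, Complex.I_mul_I]
    ring
  exact h.opOfMatrix

lemma one_add_hilbertOperator (s : ℤˣ) :
    1 + (((s : ℤ) : ℂ) * (Complex.I / (Real.pi : ℂ))) • hilbertOperator = sawtoothToeplitz s := by
  refine HasMatrix.ext (fun n m => ?_) (hasMatrix_sawtoothToeplitz s)
  rw [add_apply, smul_apply, inner_add_right,
    inner_smul_right, hasMatrix_hilbertOperator, one_apply_eq_self, inner_ket_left,
    ket_apply]

end Sawtooth

/-! ### Convergence of `∑ wₙ²` and divergence of `∑ wₙ wₘ / |n - m|`. -/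

section Series

lemma log_succ_pos {n : ℕ} (hn : 0 < n) : 0 < Real.log ((n : ℝ) + 1) :=
  Real.log_pos (by have : (0 : ℝ) < n := by exact_mod_cast hn
                   linarith)

lemma log_two_pow_add_one_le (k : ℕ) : Real.log (2 ^ k + 1) ≤ (k + 1) * Real.log 2 := by
  rw [← Nat.cast_succ, ← Real.log_pow]
  refine Real.log_le_log (by positivity) ?_
  rw [pow_succ]
  linarith [one_le_pow₀ (one_le_two : (1 : ℝ) ≤ 2) (n := k)]

/-- Cauchy condensation and `log (2^k + 1) ≥ k log 2` reduce this to `∑ 1/k²`. -/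
lemma summable_one_div_mul_log_sq :
    Summable fun n : ℕ => 1 / ((n : ℝ) * Real.log (n + 1) ^ 2) := by
  rw [← summable_condensed_iff_of_nonneg (fun n => by positivity)]
  -- The term `k = 0` is dropped: there the comparison term `1/k²` would be `1/0 = 0`.
  · rw [← summable_nat_add_iff 1]
    have hs : Summable fun k : ℕ => (Real.log 2 ^ 2)⁻¹ * (1 / ((k + 1 : ℕ) : ℝ) ^ 2) :=
      ((summable_nat_add_iff 1).2 (Real.summable_one_div_nat_pow.2 one_lt_two)).mul_left _
    refine Summable.of_nonneg_of_le (fun k => by positivity) (fun k => ?_) hs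
    have hl2 : 0 < Real.log 2 := Real.log_pos one_lt_two
    have hlog : ((k + 1 : ℕ) : ℝ) * Real.log 2 ≤ Real.log (((2 ^ (k + 1) : ℕ) : ℝ) + 1) := by
      rw [← Real.log_pow]
      refine Real.log_le_log (by positivity) ?_
      push_cast
      linarith
    have hpos : 0 < ((k + 1 : ℕ) : ℝ) * Real.log 2 := by positivity
    have h2 : (0 : ℝ) < ((2 ^ (k + 1) : ℕ) : ℝ) := by positivity
    calc (2 : ℝ) ^ (k + 1) * (1 / (((2 ^ (k + 1) : ℕ) : ℝ) *
          Real.log (((2 ^ (k + 1) : ℕ) : ℝ) + 1) ^ 2))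
        = 1 / Real.log (((2 ^ (k + 1) : ℕ) : ℝ) + 1) ^ 2 := by
          push_cast
          field_simp
      _ ≤ 1 / (((k + 1 : ℕ) : ℝ) * Real.log 2) ^ 2 := by gcongr
      _ = (Real.log 2 ^ 2)⁻¹ * (1 / ((k + 1 : ℕ) : ℝ) ^ 2) := by
          rw [mul_pow]
          field_simp
  · intro m n hm hmn
    have hm' : (0 : ℝ) < m := by exact_mod_cast hm
    have hl := log_succ_pos hm
    gcongr

/-- Condensation again, now with `log (2^k + 1) ≤ (k + 1) log 2` and the harmonic series. -/
lemma not_summable_one_div_mul_log :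
    ¬ Summable fun n : ℕ => 1 / ((n : ℝ) * Real.log (n + 1)) := by
  rw [← summable_condensed_iff_of_nonneg (fun n =>
    div_nonneg zero_le_one (mul_nonneg (by positivity) (Real.log_nonneg (by simp))))]
  · intro h
    refine Real.not_summable_one_div_natCast ((summable_nat_add_iff 1).1 ?_)
    refine Summable.of_nonneg_of_le (fun k => by positivity) (fun k => ?_) (h.mul_left (Real.log 2))
    have hl2 : 0 < Real.log 2 := Real.log_pos one_lt_two
    have hl : 0 < Real.log ((2 : ℝ) ^ k + 1) := by
      exact_mod_cast log_succ_pos (n := 2 ^ k) (by positivity)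
    have h1 := log_two_pow_add_one_le k
    push_cast
    calc (1 : ℝ) / (k + 1) = Real.log 2 * (1 / ((k + 1) * Real.log 2)) := by field_simp
      _ ≤ Real.log 2 * (1 / Real.log (2 ^ k + 1)) := by gcongr
      _ = Real.log 2 * (2 ^ k * (1 / (2 ^ k * Real.log (2 ^ k + 1)))) := by field_simp
  · intro m n hm hmn
    have hm' : (0 : ℝ) < m := by exact_mod_cast hm
    have hl := log_succ_pos hm
    gcongr

lemma weight_pos (n : ℕ+) : 0 < weight n := by
  have := log_succ_pos n.pos
  have : (0 : ℝ) < ((n : ℕ) : ℝ) := by exact_mod_cast n.pos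
  rw [weight]
  positivity

lemma weight_sq (n : ℕ+) :
    weight n ^ 2 = 1 / (((n : ℕ) : ℝ) * Real.log ((n : ℕ) + 1) ^ 2) := by
  rw [weight, div_pow, mul_pow, Real.sq_sqrt (by positivity), one_pow]

lemma summable_weight_sq : Summable fun n : ℕ+ => weight n ^ 2 := by
  simp_rw [weight_sq]
  exact summable_one_div_mul_log_sq.comp_injective PNat.coe_injective

lemma normConst_pos : 0 < normConst :=
  summable_weight_sq.tsum_pos (fun _ => sq_nonneg _) 1 (pow_pos (weight_pos 1) 2)

lemma norm_weight_le (n : ℕ+) : ‖(weight n : ℂ)‖ ≤ Real.sqrt normConst := by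
  rw [Complex.norm_real, Real.norm_of_nonneg (weight_pos n).le]
  exact Real.le_sqrt_of_sq_le (summable_weight_sq.le_tsum n fun _ _ => sq_nonneg _)

lemma hasSum_weight_sq_div : HasSum (fun n => weight n ^ 2 / normConst) 1 := by
  have h := summable_weight_sq.hasSum.div_const normConst
  rwa [show (∑' n, weight n ^ 2) = normConst from rfl, div_self normConst_pos.ne'] at h

/-- Here `n + j + 1 ≤ 2n`, so the square root and the logarithm each grow by a factor of at most 2.
-/
lemma le_weight_add (n : ℕ+) {j : ℕ} (hj : j < n) :
    weight n / 4 ≤ weight (n + j.succPNat) := by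
  have hn : (0 : ℝ) < ((n : ℕ) : ℝ) := by exact_mod_cast n.pos
  have hn1 : (1 : ℝ) ≤ ((n : ℕ) : ℝ) := by exact_mod_cast n.pos
  have hl := log_succ_pos n.pos
  have hcast : (((n + j.succPNat : ℕ+) : ℕ) : ℝ) = (n : ℕ) + (j + 1) := by
    push_cast [Nat.succPNat_coe]
    simp
  have hj' : (j : ℝ) + 1 ≤ ((n : ℕ) : ℝ) := by exact_mod_cast hj
  rw [weight, weight, hcast, div_div]
  have hs : Real.sqrt ((n : ℕ) + (j + 1)) ≤ 2 * Real.sqrt (n : ℕ) := by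
    rw [Real.sqrt_le_left (by positivity), mul_pow, Real.sq_sqrt hn.le]
    linarith
  have hlog : Real.log ((n : ℕ) + (j + 1) + 1) ≤ 2 * Real.log ((n : ℕ) + 1) := by
    rw [show (2 : ℝ) = ((2 : ℕ) : ℝ) by norm_num, ← Real.log_pow]
    refine Real.log_le_log (by positivity) ?_
    nlinarith
  have hlog0 : 0 < Real.log (((n : ℕ) : ℝ) + (j + 1) + 1) := Real.log_pos (by linarith [(j.cast_nonneg : (0:ℝ) ≤ j)])
  refine one_div_le_one_div_of_le (by positivity) ?_
  calc _ ≤ (2 * Real.sqrt (n : ℕ)) * (2 * Real.log ((n : ℕ) + 1)) := by gcongr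
    _ = _ := by ring

/-- Only `n < m ≤ 2n` is kept. There `wₘ ≥ wₙ / 4`, and the sum of `1/(m - n)` is a harmonic number,
at least `log (n+1)`; this cancels one logarithm in `wₙ²` and leaves the divergent `∑ 1/(n log
(n+1))`. -/
lemma tsum_weight_mul_weight_div {C : ℝ} (hC : 0 < C) :
    ∑' p : ℕ+ × ℕ+, ENNReal.ofReal
      (C * (weight p.1 * weight p.2 / |((p.1 : ℕ) : ℝ) - ((p.2 : ℕ) : ℝ)|)) = ⊤ := by
  set F : ℕ+ → ℕ+ → ℝ≥0∞ := fun m n => ENNReal.ofReal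
    (C * (weight m * weight n / |((m : ℕ) : ℝ) - ((n : ℕ) : ℝ)|)) with hF
  have h1 : ∑' p : ℕ+ × ℕ+, F p.1 p.2 = ∑' n, ∑' m, F m n := by
    rw [ENNReal.tsum_prod, ENNReal.tsum_comm]
  have h2 : ∀ n : ℕ+, ENNReal.ofReal (C / 4 * (1 / (((n : ℕ) : ℝ) * Real.log ((n : ℕ) + 1)))) ≤
      ∑' m, F m n := by
    intro n
    have hinj : Function.Injective fun j : ℕ => n + j.succPNat := fun a b hab => by
      simpa using hab
    refine le_trans ?_ (ENNReal.tsum_comp_le_tsum_of_injective hinj fun m => F m n)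
    refine le_trans ?_ (ENNReal.sum_le_tsum (Finset.range n))
    have h3 : ∀ j ∈ Finset.range (n : ℕ), ENNReal.ofReal (C / 4 * weight n ^ 2 * (1 / ((j : ℝ) + 1))) ≤
        F (n + j.succPNat) n := by
      intro j hj
      refine ENNReal.ofReal_le_ofReal ?_
      have hcast : (((n + j.succPNat : ℕ+) : ℕ) : ℝ) - ((n : ℕ) : ℝ) = j + 1 := by
        push_cast [Nat.succPNat_coe]
        simp
      have hw := weight_pos n
      rw [hcast, abs_of_pos (by positivity)]
      calc _ = C * (weight n / 4 * weight n / (j + 1)) := by ring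
        _ ≤ _ := by
          gcongr
          exact le_weight_add n (Finset.mem_range.1 hj)
    refine le_trans ?_ (Finset.sum_le_sum h3)
    rw [← ENNReal.ofReal_sum_of_nonneg (fun j _ => by positivity), ← Finset.mul_sum]
    refine ENNReal.ofReal_le_ofReal ?_
    have hharm : Real.log ((n : ℕ) + 1) ≤ ∑ j ∈ Finset.range (n : ℕ), 1 / ((j : ℝ) + 1) := by
      have := log_add_one_le_harmonic n
      rw [harmonic] at this
      push_cast at this
      simpa using this
    have hl := log_succ_pos n.pos
    have hn : (0 : ℝ) < ((n : ℕ) : ℝ) := by exact_mod_cast n.pos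
    calc _ = C / 4 * weight n ^ 2 * Real.log ((n : ℕ) + 1) := by
          rw [weight_sq]
          field_simp
      _ ≤ _ := by gcongr
  change ∑' p : ℕ+ × ℕ+, F p.1 p.2 = ⊤
  rw [h1]
  refine top_le_iff.1 (le_trans ?_ (ENNReal.tsum_le_tsum h2))
  by_contra hne
  have hs := ENNReal.summable_toReal (fun h => hne h.ge)
  have hs' : Summable fun n : ℕ+ => 1 / (((n : ℕ) : ℝ) * Real.log ((n : ℕ) + 1)) := by
    refine (hs.mul_left (4 / C)).congr fun n => ?_
    have hl := log_succ_pos n.pos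
    have hn : (0 : ℝ) < ((n : ℕ) : ℝ) := by exact_mod_cast n.pos
    rw [ENNReal.toReal_ofReal (by positivity)]
    field_simp
  refine not_summable_one_div_mul_log ((summable_nat_add_iff 1).1 ?_)
  exact summable_pnat_iff_summable_succ (f := fun n : ℕ => 1 / ((n : ℝ) * Real.log (n + 1))) |>.1 hs'

end Series

/-! ### The states `ω_±` and `ρ_±`, and the partial transpose. -/

section States

lemma hasMatrix_weightOperator : HasMatrix weightOperator weightMatrix :=
  HasMatrix.opOfMatrix (hasMatrix_weightedPerm (Equiv.refl ℕ+) norm_weight_le)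

lemma weightOperator_eq_diagOp :
    weightOperator = diagOp (fun n => (weight n : ℂ)) norm_weight_le :=
  HasMatrix.opOfMatrix_eq (hasMatrix_weightedPerm (Equiv.refl ℕ+) norm_weight_le)

lemma isPositive_weightOperator : weightOperator.IsPositive := by
  rw [weightOperator_eq_diagOp]
  exact isPositive_diagOp (fun n => (weight_pos n).le) norm_weight_le

lemma weightOperator_ket (n : ℕ+) : weightOperator (ket n) = (weight n : ℂ) • ket n := by
  rw [weightOperator_eq_diagOp, diagOp_ket]

lemma omega_eq (s : ℤˣ) :
    omega s = (normConst : ℂ)⁻¹ • (weightOperator * sawtoothToeplitz s * weightOperator) := by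
  rw [omega, one_add_hilbertOperator]

lemma isPositive_omega (s : ℤˣ) : (omega s).IsPositive := by
  rw [omega_eq]
  refine ContinuousLinearMap.IsPositive.smul_of_nonneg ?_ ?_
  · have h := (isPositive_sawtoothToeplitz s).conj_adjoint weightOperator
    rw [isPositive_weightOperator.isSelfAdjoint.adjoint_eq] at h
    exact h
  · rw [inv_nonneg]
    exact_mod_cast normConst_pos.le

lemma inner_ket_omega (s : ℤˣ) (n m : ℕ+) :
    ⟪ket n, omega s (ket m)⟫_ℂ = (normConst : ℂ)⁻¹ * (weight n * weight m *
      ((if n = m then 1 else 0) + ((s : ℤ) : ℂ) * (Complex.I / Real.pi) * hilbertMatrix n m)) := by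
  rw [omega_eq, smul_apply, mul_apply_eq_comp, mul_apply_eq_comp, inner_smul_right,
    ← isPositive_weightOperator.isSelfAdjoint.adjoint_eq,
    ContinuousLinearMap.adjoint_inner_right, isPositive_weightOperator.isSelfAdjoint.adjoint_eq,
    weightOperator_ket, weightOperator_ket, map_smul, inner_smul_left, inner_smul_right,
    hasMatrix_sawtoothToeplitz, Complex.conj_ofReal]
  ring

lemma inner_ket_omega_self (s : ℤˣ) (n : ℕ+) :
    ⟪ket n, omega s (ket n)⟫_ℂ = ((weight n ^ 2 / normConst : ℝ) : ℂ) := by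
  rw [inner_ket_omega, hilbertMatrix]
  push_cast
  simp
  ring

lemma omega_mem_densityOperators (s : ℤˣ) : omega s ∈ densityOperators ℕ+ := by
  refine ⟨isPositive_omega s, ?_⟩
  simp_rw [inner_ket_omega_self]
  rw [← Complex.ofReal_one, Complex.hasSum_ofReal]
  exact hasSum_weight_sq_div

lemma orthonormal_ket_diag : Orthonormal ℂ fun n : ℕ+ => (ket (n, n) : HAB) := by
  rw [orthonormal_iff_ite]
  intro n m
  rw [inner_ket_left, ket_apply]
  simp

/-- The isometry `|n⟩ ↦ |nn⟩`. -/
noncomputable def diagEmbedding : HA →L[ℂ] HAB :=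
  orthonormal_ket_diag.orthogonalFamily.linearIsometry.toContinuousLinearMap

lemma diagEmbedding_ket (n : ℕ+) : diagEmbedding (ket n) = ket (n, n) := by
  have h := orthonormal_ket_diag.orthogonalFamily.linearIsometry_apply_single (i := n) (1 : ℂ)
  exact h.trans (one_smul ℂ _)

lemma adjoint_diagEmbedding_ket (p : ℕ+ × ℕ+) :
    ContinuousLinearMap.adjoint diagEmbedding (ket p) = if p.1 = p.2 then ket p.1 else 0 := by
  ext n
  rw [← inner_ket_left, ContinuousLinearMap.adjoint_inner_right, diagEmbedding_ket,
    inner_ket_left, ket_apply]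
  obtain ⟨a, b⟩ := p
  by_cases hab : a = b
  · subst hab
    simp [ket_apply]
  · rw [if_neg hab, if_neg]
    · rfl
    · rintro h
      simp only [Prod.mk.injEq] at h
      exact hab (h.1.symm.trans h.2)

/-- Realising `ρ` as `V ω V†`, with `V` the isometry `|n⟩ ↦ |nn⟩`, gives both its existence and its
positivity. -/
lemma hasMatrix_diagEmbedding_conj (s : ℤˣ) :
    HasMatrix (diagEmbedding ∘L omega s ∘L ContinuousLinearMap.adjoint diagEmbedding)
      (rhoMatrix s) := by
  intro p q
  rw [ContinuousLinearMap.comp_apply, ← ContinuousLinearMap.adjoint_inner_left,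
    ContinuousLinearMap.comp_apply, adjoint_diagEmbedding_ket, adjoint_diagEmbedding_ket, rhoMatrix]
  by_cases hp : p.1 = p.2 <;> by_cases hq : q.1 = q.2 <;> simp [hp, hq]

lemma hasMatrix_rho (s : ℤˣ) : HasMatrix (rho s) (rhoMatrix s) :=
  (hasMatrix_diagEmbedding_conj s).opOfMatrix

lemma isPositive_rho (s : ℤˣ) : (rho s).IsPositive := by
  rw [rho, (hasMatrix_diagEmbedding_conj s).opOfMatrix_eq]
  exact (isPositive_omega s).conj_adjoint diagEmbedding

lemma hasSum_diag {M : Type*} [AddCommMonoid M] [TopologicalSpace M] {f : ℕ+ → M} {a : M}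
    (hf : HasSum f a) : HasSum (fun p : ℕ+ × ℕ+ => if p.1 = p.2 then f p.1 else 0) a := by
  have hinj : Function.Injective fun n : ℕ+ => (n, n) := fun a b h => (Prod.mk.inj h).1
  refine (hinj.hasSum_iff ?_).1 ?_
  · rintro ⟨a, b⟩ h
    refine if_neg fun hab => h ⟨a, ?_⟩
    simp only at hab
    rw [hab]
  · simpa [Function.comp_def] using hf

lemma rho_mem_densityOperators (s : ℤˣ) : rho s ∈ densityOperators (ℕ+ × ℕ+) := by
  refine ⟨isPositive_rho s, ?_⟩
  have h := hasSum_diag (omega_mem_densityOperators s).2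
  refine h.congr_fun fun p => ?_
  rw [hasMatrix_rho, rhoMatrix]
  simp

lemma norm_inner_ket_omega_le (s : ℤˣ) (p : ℕ+ × ℕ+) :
    ‖⟪ket p.1, omega s (ket p.2)⟫_ℂ‖ ≤ ‖omega s‖ := by
  refine (norm_inner_le_norm _ _).trans ?_
  rw [norm_ket, one_mul]
  simpa [norm_ket] using (omega s).le_opNorm (ket p.2)

/-- The entry `⟨ad|ρ|cb⟩` vanishes unless `a = d` and `b = c`, so `ρ^Γ` is the swap weighted by the
entries `ω_{ab}`. -/
lemma hasMatrix_partialTranspose_rho (s : ℤˣ) :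
    HasMatrix (weightedPerm (Equiv.prodComm ℕ+ ℕ+) _ (norm_inner_ket_omega_le s))
      (partialTransposeMatrix (rho s)) := by
  intro p q
  rw [hasMatrix_weightedPerm, partialTransposeMatrix, hasMatrix_rho, rhoMatrix]
  simp only
  obtain ⟨a, b⟩ := p
  obtain ⟨c, d⟩ := q
  by_cases h : b = c ∧ a = d
  · obtain ⟨rfl, rfl⟩ := h
    simp
  · rw [if_neg (fun h' => h (Prod.mk.inj h') : ¬ Equiv.prodComm ℕ+ ℕ+ (a, b) = (c, d)), if_neg fun h' => h ⟨h'.2.symm, h'.1⟩]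

lemma le_norm_inner_ket_omega (s : ℤˣ) (n m : ℕ+) :
    (normConst * Real.pi)⁻¹ * (weight n * weight m / |((n : ℕ) : ℝ) - ((m : ℕ) : ℝ)|) ≤
      ‖⟪ket n, omega s (ket m)⟫_ℂ‖ := by
  by_cases h : n = m
  -- On the diagonal the left side is a division by zero, hence `0`.
  · simp [h]
  · refine le_of_eq ?_
    have hs : ‖((s : ℤ) : ℂ)‖ = 1 := by
      rcases Int.units_eq_one_or s with rfl | rfl <;> simp
    have hsub : ‖((n : ℕ) : ℂ) - ((m : ℕ) : ℂ)‖ = |((n : ℕ) : ℝ) - ((m : ℕ) : ℝ)| := by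
      rw [← Real.norm_eq_abs, ← Complex.norm_real]
      push_cast
      rfl
    rw [inner_ket_omega, hilbertMatrix, if_neg h, if_neg h, zero_add]
    simp only [norm_mul, norm_inv, norm_div, hs, hsub, Complex.norm_I, Complex.norm_real,
      Real.norm_of_nonneg normConst_pos.le, Real.norm_of_nonneg Real.pi_pos.le,
      Real.norm_of_nonneg (weight_pos n).le, Real.norm_of_nonneg (weight_pos m).le, norm_one]
    rw [mul_inv]
    ring

lemma tsum_norm_inner_ket_omega (s : ℤˣ) :
    ∑' p : ℕ+ × ℕ+, ENNReal.ofReal ‖⟪ket p.1, omega s (ket p.2)⟫_ℂ‖ = ⊤ := by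
  have hC : 0 < (normConst * Real.pi)⁻¹ := inv_pos.2 (mul_pos normConst_pos Real.pi_pos)
  refine top_le_iff.1 ((tsum_weight_mul_weight_div hC).ge.trans ?_)
  exact ENNReal.tsum_le_tsum fun p => ENNReal.ofReal_le_ofReal (le_norm_inner_ket_omega s p.1 p.2)

lemma traceNorm_partialTranspose_rho (s : ℤˣ) : traceNorm (partialTranspose (rho s)) = ⊤ := by
  rw [partialTranspose, (hasMatrix_partialTranspose_rho s).opOfMatrix_eq, traceNorm_weightedPerm,
    tsum_norm_inner_ket_omega]

lemma negativity_rho (s : ℤˣ) : negativity (rho s) = ⊤ := by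
  rw [negativity, traceNorm_partialTranspose_rho, EReal.coe_ennreal_top]
  have h1 : (⊤ : EReal) - 1 = ⊤ := EReal.top_sub_coe 1
  rw [h1]
  exact EReal.top_div_of_pos_ne_top (by norm_num) (EReal.coe_ne_top 2)

end States

/-! ### Separable states and the two robustness measures. -/

section Separable

/-- The double sum factors as `(∑ |ψₐ| |φₐ|)²`. Cauchy–Schwarz bounds it by `∑ |ψₐ|² ∑ |φ_b|²`, a
partial sum of `‖Ψ‖²`, so `ψ` and `φ` need not be normalised separately. -/
lemma sum_norm_inner_ket_le_of_productState {P : HAB →L[ℂ] HAB} (hP : P ∈ productStates)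
    (t : Finset ℕ+) :
    ∑ a ∈ t, ∑ b ∈ t, ‖⟪(ket (a, a) : HAB), P (ket (b, b))⟫_ℂ‖ ≤ 1 := by
  obtain ⟨Ψ, ψ, φ, hΨ, hten, rfl⟩ := hP
  have h1 : ∀ a b : ℕ+, ‖⟪(ket (a, a) : HAB),
      InnerProductSpace.rankOne ℂ Ψ Ψ (ket (b, b))⟫_ℂ‖ = (‖ψ a‖ * ‖φ a‖) * (‖ψ b‖ * ‖φ b‖) := by
    intro a b
    rw [InnerProductSpace.rankOne_apply, inner_smul_right, inner_ket_left, inner_ket_right,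
      norm_mul, norm_star, hten, hten, norm_mul, norm_mul, mul_comm]
  simp_rw [h1]
  rw [← Finset.sum_mul_sum, ← sq]
  refine (Finset.sum_mul_sq_le_sq_mul_sq t _ _).trans ?_
  rw [Finset.sum_mul_sum, ← Finset.sum_product']
  calc ∑ p ∈ t ×ˢ t, ‖ψ p.1‖ ^ 2 * ‖φ p.2‖ ^ 2 = ∑ p ∈ t ×ˢ t, ‖Ψ p‖ ^ 2 := by
        refine Finset.sum_congr rfl fun p _ => ?_
        rw [hten p.1 p.2, norm_mul, mul_pow]
    _ ≤ ∑' p, ‖Ψ p‖ ^ 2 := (summable_norm_sq Ψ).sum_le_tsum _ fun p _ => sq_nonneg _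
    _ = 1 := by rw [← norm_sq_eq_tsum, hΨ, one_pow]

/-- The bound is convex in the operator and, as `t` is finite, survives entrywise limits. -/
lemma sum_norm_inner_ket_le_of_separable {σ : HAB →L[ℂ] HAB} (hσ : σ ∈ separableStates)
    (t : Finset ℕ+) :
    ∑ a ∈ t, ∑ b ∈ t, ‖⟪(ket (a, a) : HAB), σ (ket (b, b))⟫_ℂ‖ ≤ 1 := by
  obtain ⟨ξ, hξ, hlim⟩ := hσ
  have hconv : Convex ℝ {σ : HAB →L[ℂ] HAB |
      ∑ a ∈ t, ∑ b ∈ t, ‖⟪(ket (a, a) : HAB), σ (ket (b, b))⟫_ℂ‖ ≤ 1} := by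
    intro S hS T hT x y hx hy hxy
    have hle : ∀ a b : ℕ+, ‖⟪(ket (a, a) : HAB), (x • S + y • T) (ket (b, b))⟫_ℂ‖ ≤
        x * ‖⟪(ket (a, a) : HAB), S (ket (b, b))⟫_ℂ‖ +
          y * ‖⟪(ket (a, a) : HAB), T (ket (b, b))⟫_ℂ‖ := by
      intro a b
      rw [add_apply, smul_apply, smul_apply, inner_add_right, inner_smul_right_eq_smul,
        inner_smul_right_eq_smul]
      refine (norm_add_le _ _).trans ?_
      rw [norm_smul, norm_smul, Real.norm_of_nonneg hx, Real.norm_of_nonneg hy]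
    refine (Finset.sum_le_sum fun a _ => Finset.sum_le_sum fun b _ => hle a b).trans ?_
    simp_rw [Finset.sum_add_distrib, ← Finset.mul_sum]
    calc _ ≤ x * 1 + y * 1 := by
          gcongr
          · exact hS
          · exact hT
      _ = 1 := by rw [mul_one, mul_one, hxy]
  have hmem := convexHull_min (fun P hP => sum_norm_inner_ket_le_of_productState hP t) hconv
  refine le_of_tendsto' (x := atTop) ?_ fun k => hmem (hξ k)
  exact tendsto_finsetSum _ fun a _ => tendsto_finsetSum _ fun b _ =>
    (hlim.tendsto_inner_ket _ _).norm

lemma standardRobustness_rho (s : ℤˣ) : standardRobustness separableStates (rho s) = ⊤ := by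
  rw [standardRobustness, sInf_eq_top]
  rintro r ⟨t, ht, -, σ, hσ, hmix⟩
  exfalso
  obtain ⟨τ, hτ⟩ : ∃ τ, τ = ((1 + t : ℝ) : ℂ)⁻¹ • (rho s + (t : ℂ) • σ) := ⟨_, rfl⟩
  rw [← hτ] at hmix
  have h0 : ((1 + t : ℝ) : ℂ) ≠ 0 := by
    exact_mod_cast (by positivity : (1 + t : ℝ) ≠ 0)
  have hρ : rho s = ((1 + t : ℝ) : ℂ) • τ - (t : ℂ) • σ := by
    rw [hτ, smul_smul, mul_inv_cancel₀ h0, one_smul, add_sub_cancel_right]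
  have hentry : ∀ a b : ℕ+, ‖⟪ket a, omega s (ket b)⟫_ℂ‖ ≤
      (1 + t) * ‖⟪(ket (a, a) : HAB), τ (ket (b, b))⟫_ℂ‖ +
        t * ‖⟪(ket (a, a) : HAB), σ (ket (b, b))⟫_ℂ‖ := by
    intro a b
    have h1 : ⟪ket a, omega s (ket b)⟫_ℂ = ⟪(ket (a, a) : HAB), rho s (ket (b, b))⟫_ℂ := by
      rw [hasMatrix_rho, rhoMatrix]
      simp
    rw [h1, hρ, sub_apply, smul_apply, smul_apply, inner_sub_right, inner_smul_right,
      inner_smul_right]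
    refine (norm_sub_le _ _).trans ?_
    rw [norm_mul, norm_mul, Complex.norm_real, Complex.norm_real, Real.norm_of_nonneg ht,
      Real.norm_of_nonneg (by positivity)]
  have hbound : ∀ u : Finset (ℕ+ × ℕ+),
      ∑ p ∈ u, ENNReal.ofReal ‖⟪ket p.1, omega s (ket p.2)⟫_ℂ‖ ≤ ENNReal.ofReal (1 + t + t) := by
    intro u
    rw [← ENNReal.ofReal_sum_of_nonneg fun _ _ => norm_nonneg _]
    refine ENNReal.ofReal_le_ofReal ?_
    -- The separable bound concerns squares `v ×ˢ v`, so `u` is enclosed in one.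
    set v := u.image Prod.fst ∪ u.image Prod.snd with hv
    have hsub : u ⊆ v ×ˢ v := fun p hp => Finset.mem_product.2
      ⟨Finset.mem_union_left _ (Finset.mem_image_of_mem _ hp),
        Finset.mem_union_right _ (Finset.mem_image_of_mem _ hp)⟩
    refine (Finset.sum_le_sum_of_subset_of_nonneg hsub fun _ _ _ => norm_nonneg _).trans ?_
    rw [Finset.sum_product]
    refine (Finset.sum_le_sum fun a _ => Finset.sum_le_sum fun b _ => hentry a b).trans ?_
    simp_rw [Finset.sum_add_distrib, ← Finset.mul_sum]
    calc _ ≤ (1 + t) * 1 + t * 1 := by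
          gcongr
          · exact sum_norm_inner_ket_le_of_separable hmix v
          · exact sum_norm_inner_ket_le_of_separable hσ v
      _ = 1 + t + t := by ring
  have h2 : ∑' p : ℕ+ × ℕ+, ENNReal.ofReal ‖⟪ket p.1, omega s (ket p.2)⟫_ℂ‖ ≤
      ENNReal.ofReal (1 + t + t) := by
    rw [ENNReal.tsum_eq_iSup_sum]
    exact iSup_le hbound
  rw [tsum_norm_inner_ket_omega] at h2
  exact ENNReal.ofReal_ne_top (top_le_iff.1 h2)

lemma traceNorm_zero {ι : Type} [DecidableEq ι] :
    traceNorm (0 : ℓ²(ι, ℂ) →L[ℂ] ℓ²(ι, ℂ)) = 0 := by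
  have h : (0 : ℓ²(ι, ℂ) →L[ℂ] ℓ²(ι, ℂ)) =
      diagOp (fun _ => 0) (C := 0) (fun _ => norm_zero.le) := by
    refine clm_ext_ket fun i => ?_
    rw [diagOp_ket, zero_smul, zero_apply]
  rw [h, traceNorm_weightedPerm]
  simp

lemma rankOne_ket_mem_productStates (n m : ℕ+) :
    InnerProductSpace.rankOne ℂ (ket (n, m) : HAB) (ket (n, m)) ∈ productStates := by
  refine ⟨_, ket n, ket m, norm_ket _, fun a b => ?_, rfl⟩
  rw [ket_apply, ket_apply, ket_apply]
  by_cases ha : a = n <;> by_cases hb : b = m <;> simp [ha, hb]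

/-- The truncations of `T` to `n ≤ k + 1`, renormalised by their traces `S k`, are finite convex
combinations of product states. Their differences from `T` are diagonal, so trace-norm convergence
is `ℓ¹` convergence of the weights. -/
lemma mem_separableStates_of_hasSum {p : ℕ+ → ℝ} (hp : ∀ n, 0 < p n) (hsum : HasSum p 1)
    {T : HAB →L[ℂ] HAB}
    (hT : ∀ q : ℕ+ × ℕ+, T (ket q) = (if q.1 = q.2 then (p q.1 : ℂ) else 0) • ket q) :
    T ∈ separableStates := by
  set I : ℕ → Finset ℕ+ := fun k => Finset.Iic k.succPNat with hI
  have hIlim : Tendsto I atTop atTop := by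
    refine tendsto_atTop_finset_of_monotone ?_ ?_
    · intro a b hab
      refine Finset.Iic_subset_Iic.2 ?_
      exact Nat.succPNat_le_succPNat.2 hab
    · intro n
      refine ⟨n, ?_⟩
      rw [hI, Finset.mem_Iic, ← PNat.coe_le_coe, Nat.succPNat_coe]
      omega
  set S : ℕ → ℝ := fun k => ∑ n ∈ I k, p n with hS
  have hSlim : Tendsto S atTop (𝓝 1) := hsum.comp hIlim
  have h1I : ∀ k, 1 ∈ I k := fun k => Finset.mem_Iic.2 (one_le)
  have hS1 : ∀ k, p 1 ≤ S k := fun k =>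
    Finset.single_le_sum (f := p) (fun n _ => (hp n).le) (h1I k)
  have hS0 : ∀ k, 0 < S k := fun k => (hp 1).trans_le (hS1 k)
  set u : ℕ → ℕ+ → ℝ := fun k n => (if n ∈ I k then p n / S k else 0) - p n with hu
  -- Since `1 ∈ I k` always, `S k ≥ p 1 > 0`; this gives a summable majorant independent of `k`, as
  -- dominated convergence requires.
  have hubound : ∀ k n, ‖u k n‖ ≤ p n * ((p 1)⁻¹ + 1) := by
    intro k n
    refine (norm_sub_le _ _).trans ?_
    rw [Real.norm_of_nonneg (hp n).le, mul_add, mul_one]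
    refine add_le_add_left ?_ _
    split_ifs
    · rw [Real.norm_of_nonneg (div_nonneg (hp n).le (hS0 k).le), div_eq_mul_inv]
      exact mul_le_mul_of_nonneg_left (inv_anti₀ (hp 1) (hS1 k)) (hp n).le
    · rw [norm_zero]
      exact mul_nonneg (hp n).le (inv_nonneg.2 (hp 1).le)
  have hbsum : Summable fun n => p n * ((p 1)⁻¹ + 1) := hsum.summable.mul_right _
  have hubound' : ∀ k (q : ℕ+ × ℕ+),
      ‖if q.1 = q.2 then (u k q.1 : ℂ) else 0‖ ≤ ∑' n, p n * ((p 1)⁻¹ + 1) := by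
    intro k q
    have hnn : ∀ n, 0 ≤ p n * ((p 1)⁻¹ + 1) := fun n => (norm_nonneg _).trans (hubound k n)
    split_ifs
    · rw [Complex.norm_real]
      exact (hubound k q.1).trans (hbsum.le_tsum _ fun n _ => hnn n)
    · rw [norm_zero]
      exact tsum_nonneg hnn
  refine ⟨fun k => ∑ n ∈ I k, (p n / S k) •
    InnerProductSpace.rankOne ℂ (ket (n, n) : HAB) (ket (n, n)), fun k => ?_, ?_⟩
  · refine (convex_convexHull ℝ _).sum_mem (fun n _ => div_nonneg (hp n).le (hS0 k).le) ?_
      fun n _ => subset_convexHull ℝ _ (rankOne_ket_mem_productStates n n)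
    rw [← Finset.sum_div]
    exact div_self (hS0 k).ne'
  · have hdiff : ∀ k, (∑ n ∈ I k, (p n / S k) •
        InnerProductSpace.rankOne ℂ (ket (n, n) : HAB) (ket (n, n))) - T =
          diagOp (fun q => if q.1 = q.2 then (u k q.1 : ℂ) else 0) (hubound' k) := by
      intro k
      refine clm_ext_ket fun q => ?_
      rw [diagOp_ket, sub_apply, hT, sum_apply]
      simp only [smul_apply, InnerProductSpace.rankOne_apply, inner_ket_left, ket_apply]
      obtain ⟨a, b⟩ := q
      by_cases hab : a = b
      · subst hab
        rw [if_pos rfl, if_pos rfl, hu]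
        simp only [Prod.mk.injEq, and_self, ite_smul, one_smul, zero_smul, smul_ite, smul_zero,
          Finset.sum_ite_eq']
        push_cast
        rw [sub_smul]
        congr 1
        split_ifs
        · exact (Complex.coe_smul _ _).symm
        · simp
      · rw [if_neg hab, if_neg hab, zero_smul, sub_zero]
        refine Finset.sum_eq_zero fun n _ => ?_
        rw [if_neg fun h => hab ?_, zero_smul, smul_zero]
        exact (Prod.mk.inj h).1.symm.trans (Prod.mk.inj h).2
    have hnorm : ∀ k, traceNorm (diagOp (fun q : ℕ+ × ℕ+ =>
        if q.1 = q.2 then (u k q.1 : ℂ) else 0) (hubound' k)) = ENNReal.ofReal (∑' n, ‖u k n‖) := by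
      intro k
      rw [traceNorm_weightedPerm, ENNReal.ofReal_tsum_of_nonneg (fun _ => norm_nonneg _)
        (Summable.of_nonneg_of_le (fun _ => norm_nonneg _) (hubound k) hbsum)]
      rw [← (hasSum_diag (ENNReal.summable (f := fun n => ENNReal.ofReal ‖u k n‖)).hasSum).tsum_eq]
      refine tsum_congr fun q => ?_
      split_ifs
      · rw [Complex.norm_real]
      · simp
    have hlim : Tendsto (fun k => ∑' n, ‖u k n‖) atTop (𝓝 (∑' _ : ℕ+, (0 : ℝ))) := by
      refine tendsto_tsum_of_dominated_convergence hbsum (fun n => ?_)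
        (Eventually.of_forall fun k n => by simpa using hubound k n)
      rw [← norm_zero (E := ℝ)]
      refine Tendsto.norm ?_
      have h1 : Tendsto (fun k => p n / S k - p n) atTop (𝓝 0) := by
        have := (tendsto_const_nhds (x := p n)).div hSlim one_ne_zero
        simpa using this.sub_const (p n)
      refine h1.congr' ?_
      filter_upwards [hIlim.eventually (eventually_ge_atTop {n})] with k hk
      rw [hu]
      simp only
      rw [if_pos (hk (Finset.mem_singleton_self n))]
    simp only [TraceNormTendsto, hdiff, hnorm]
    rw [tsum_zero] at hlim
    simpa using ENNReal.tendsto_ofReal hlim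

lemma half_rho_add_rho_mem : (1 / 2 : ℂ) • (rho 1 + rho (-1)) ∈ separableStates := by
  refine mem_separableStates_of_hasSum (p := fun n => weight n ^ 2 / normConst)
    (fun n => div_pos (pow_pos (weight_pos n) 2) normConst_pos) hasSum_weight_sq_div fun q => ?_
  ext r
  rw [← inner_ket_left, smul_apply, add_apply, inner_smul_right, inner_add_right, hasMatrix_rho,
    hasMatrix_rho, lp.coeFn_smul, Pi.smul_apply, ket_apply, rhoMatrix, rhoMatrix, inner_ket_omega,
    inner_ket_omega]
  obtain ⟨a, b⟩ := r
  obtain ⟨c, d⟩ := q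
  by_cases hab : a = b <;> by_cases hcd : c = d
  · subst hab hcd
    by_cases hac : a = c
    · subst hac
      simp [hilbertMatrix]
      ring
    · simp [hac]
  · simp [hcd]
  · subst hcd
    have : ¬ (a = c ∧ b = c) := fun h => hab (h.1.trans h.2.symm)
    simp [hab, this]
  · simp [hab, hcd]

lemma generalizedRobustness_rho_le (s : ℤˣ) :
    generalizedRobustness separableStates (rho s) ≤ 2 := by
  -- The witness is `t = 1` with constant sequences: `ξ = ρ_s` itself, mixed with the opposite-sign
  -- state.
  refine sInf_le ⟨1, zero_le_one, by norm_num, fun _ => rho s, fun _ => rho (-s), ?_, fun _ =>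
    ⟨rho_mem_densityOperators _, ?_⟩⟩
  · simp only [TraceNormTendsto, sub_self, traceNorm_zero]
    exact tendsto_const_nhds
  · have h := half_rho_add_rho_mem
    have hc : ((1 + 1 : ℝ) : ℂ)⁻¹ = 1 / 2 := by
      push_cast
      norm_num
    rw [hc, Complex.ofReal_one, one_smul]
    rcases Int.units_eq_one_or s with rfl | rfl
    · exact h
    · rwa [neg_neg, add_comm]

end Separable

theorem mainTheorem9 :
    -- the operators are well defined: bounded operators with the prescribed matrices exist
    HasMatrix hilbertOperator hilbertMatrix ∧
    HasMatrix weightOperator weightMatrix ∧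
    (Summable fun n : ℕ+ => weight n ^ 2) ∧ 0 < normConst ∧
    (∀ s : ℤˣ, HasMatrix (rho s) (rhoMatrix s)) ∧
    (∀ s : ℤˣ, HasMatrix (partialTranspose (rho s)) (partialTransposeMatrix (rho s))) ∧
    -- `ω_±` and `ρ_±` are states
    (∀ s : ℤˣ, omega s ∈ densityOperators ℕ+) ∧
    (∀ s : ℤˣ, rho s ∈ densityOperators (ℕ+ × ℕ+)) ∧
    -- infinite negativity and standard robustness
    (∀ s : ℤˣ, traceNorm (partialTranspose (rho s)) = ⊤) ∧
    (∀ s : ℤˣ, negativity (rho s) = ⊤) ∧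
    (∀ s : ℤˣ, standardRobustness separableStates (rho s) = ⊤) ∧
    -- the balanced mixture is separable, and the generalized robustness is at most two
    (1 / 2 : ℂ) • (rho 1 + rho (-1)) ∈ separableStates ∧
    (∀ s : ℤˣ, generalizedRobustness separableStates (rho s) ≤ 2) := by

  exact ⟨hasMatrix_hilbertOperator, hasMatrix_weightOperator, summable_weight_sq, normConst_pos,
    hasMatrix_rho, fun s => (hasMatrix_partialTranspose_rho s).opOfMatrix,
    omega_mem_densityOperators, rho_mem_densityOperators, traceNorm_partialTranspose_rho,
    negativity_rho, standardRobustness_rho, half_rho_add_rho_mem, generalizedRobustness_rho_le⟩
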